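/- For real four-vectors $x=(x^0,x^1,x^2,x^3)$ write $x\cdot y=x^0y^0-x^1y^1-x^2y^2-x^3y^3$ and $x^2=x\cdot x$. Let $\mathbb V=\{(\sqrt{m^2+|\vec p|^2},\vec p) : \vec p\in\mathbb R^3,\ m\ge 0\}$ be the set of forward-time-directed non-spacelike four-vectors. Let $[x,y,z,w]=\epsilon_{\mu\nu\sigma\tau}x^\mu y^\nu z^\sigma w^\tau$ be the contraction with the totally antisymmetric tensor, normalised by $\epsilon_{0123}=1$ (only its vanishing matters below, so the sign convention is irrelevant), let $$G(x_1,x_2;y_1,y_2)=\det\begin{pmatrix}x_1\cdot y_1&x_1\cdot y_2\\x_2\cdot y_1&x_2\cdot y_2\end{pmatrix},\qquad \Delta_3(x_1,x_2,x_3)=\det\,(x_i\cdot x_j)_{i,j=1}^3 ,$$ and, for given $p,q$, abbreviate $g^x_y=G(x,p+q;\,y,p+q)$. An event of the class $(pq)\to(abc)+X$ is a tuple $(p,q,a,b,c)\in\mathbb V^5$. The group $SO^+(1,3)\times S_2\times S_3$ acts on events: the proper orthochronous Lorentz group $SO^+(1,3)$ acts on all five momenta simultaneously, $S_2$ permutes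 $(p,q)$ and $S_3$ permutes $(a,b,c)$. The parity operator $\mathscr P$ replaces each momentum $(E,\vec k)$ by $(E,-\vec k)$. An event $e$ is non-chiral if $e=g\cdot\mathscr P e$ for some $g$ in this group, and chiral otherwise. It is a collision event if $p^2q^2<(p\cdot q)^2$. **Theorem.** A collision event $(p,q,a,b,c)$ is chiral if and only if the condition $C$ holds, where $C$ is the conjunction of the following four conditions: 1. $[a,b,p,q]\ne0$ or $[b,c,p,q]\ne0$ or $[c,a,p,q]\ne0$; 2. for each $(x,y)\in\{(a,b),(b,c),(c,a)\}$: $\;x^2\ne y^2$ or $g^{x-y}_{p-q}\ne0$ or $g^{x-y}_{x+y}\ne0$ or $g^{x-y}_{a+b+c}\ne0$ or $x=y$; 3. $p^2\ne q^2$ or $g^{a}_{p-q}\ne0$ or $g^{b}_{p-q}\ne0$ or $g^{c}_{p-q}\ne0$; 4. $p^2\ne q^2$ or $g^{a+b+c}_{p-q}\ne0$ or, for each $(x,y)\in\{(a,b),(b,c),(c,a)\}$: $\;x^2\ne y^2$ or $g^{x+y}_{p-q}\ne0$ or $\Delta_3(x-y,p,q)\ne0$. -/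

import Mathlib

open scoped Matrix

noncomputable section

namespace Collider

/-- Real four-vectors `(E, x, y, z)`; index `0` is the energy. -/
abbrev FourVector : Type := Fin 4 → ℝ

/-- The Lorentz product with signature `(+,-,-,-)`. -/
def mdot (x y : FourVector) : ℝ := x 0 * y 0 - x 1 * y 1 - x 2 * y 2 - x 3 * y 3

/-- The invariant square `x² = x.x`. -/
def msq (x : FourVector) : ℝ := mdot x x

/-- The contraction `[a,b,c,d] = ε_{μνστ} a^μ b^ν c^σ d^τ` of four vectors with the alternating
tensor, with the sign convention `ε_{0123} = 1`. -/
def bracket (a b c d : FourVector) : ℝ := Matrix.det (Matrix.of ![a, b, c, d])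

/-- The Gram determinant `G(x₁, x₂; y₁, y₂) = det (xᵢ.yⱼ)`. -/
def gramTwo (x₁ x₂ y₁ y₂ : FourVector) : ℝ :=
  Matrix.det !![mdot x₁ y₁, mdot x₁ y₂; mdot x₂ y₁, mdot x₂ y₂]

/-- The symmetric Gram determinant `Δ₃(x₁, x₂, x₃) = det (xᵢ.xⱼ)`. -/
def symGramThree (x₁ x₂ x₃ : FourVector) : ℝ :=
  Matrix.det !![mdot x₁ x₁, mdot x₁ x₂, mdot x₁ x₃;
                mdot x₂ x₁, mdot x₂ x₂, mdot x₂ x₃;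
                mdot x₃ x₁, mdot x₃ x₂, mdot x₃ x₃]

/-- The set of forward-time-directed non-spacelike four-vectors `(√(m² + |p|²), p)`, `m ≥ 0`. -/
def forwardCone : Set FourVector :=
  {x | ∃ m : ℝ, 0 ≤ m ∧ x 0 = Real.sqrt (m ^ 2 + (x 1 ^ 2 + x 2 ^ 2 + x 3 ^ 2))}

lemma mem_forwardCone_iff (x : FourVector) : x ∈ forwardCone ↔ 0 ≤ x 0 ∧ 0 ≤ msq x := by
  simp only [forwardCone, Set.mem_ofPred_eq, msq, mdot]
  constructor
  · rintro ⟨m, -, h⟩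
    have h0 : 0 ≤ m ^ 2 + (x 1 ^ 2 + x 2 ^ 2 + x 3 ^ 2) := by positivity
    have hs := Real.sq_sqrt h0
    rw [← h] at hs
    exact ⟨h ▸ Real.sqrt_nonneg _, by nlinarith [sq_nonneg m]⟩
  · rintro ⟨h0, h⟩
    refine ⟨Real.sqrt (x 0 * x 0 - x 1 * x 1 - x 2 * x 2 - x 3 * x 3), Real.sqrt_nonneg _, ?_⟩
    rw [Real.sq_sqrt h, eq_comm, Real.sqrt_eq_iff_mul_self_eq (by nlinarith) h0]
    ring

/-- The Minkowski metric `diag(1,-1,-1,-1)`. -/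
def metric : Matrix (Fin 4) (Fin 4) ℝ := Matrix.diagonal ![1, -1, -1, -1]

lemma metric_mul_metric : metric * metric = 1 := by
  rw [metric, Matrix.diagonal_mul_diagonal, ← Matrix.diagonal_one]
  congr 1
  ext i
  fin_cases i <;> simp

lemma mdot_eq (x y : FourVector) : mdot x y = x ⬝ᵥ (metric *ᵥ y) := by
  simp [mdot, metric, dotProduct, Matrix.mulVec_diagonal, Fin.sum_univ_four]
  ring

lemma lorentz_transpose {L : Matrix (Fin 4) (Fin 4) ℝ} (h : Lᵀ * metric * L = metric) :
    L * metric * Lᵀ = metric := by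
  have h1 : (metric * Lᵀ * metric) * L = 1 := by
    rw [Matrix.mul_assoc, Matrix.mul_assoc, ← Matrix.mul_assoc Lᵀ, h, metric_mul_metric]
  have h2 := mul_eq_one_comm.mp h1
  calc L * metric * Lᵀ = (L * (metric * Lᵀ * metric)) * metric := by
        simp only [Matrix.mul_assoc, metric_mul_metric, Matrix.mul_one]
    _ = metric := by rw [h2, Matrix.one_mul]

lemma lorentz_row {L : Matrix (Fin 4) (Fin 4) ℝ} (h : Lᵀ * metric * L = metric) :
    L 0 0 ^ 2 = 1 + (L 0 1 ^ 2 + L 0 2 ^ 2 + L 0 3 ^ 2) := by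
  have := congrFun (congrFun (lorentz_transpose h) 0) 0
  simp [metric, Matrix.mul_apply, Fin.sum_univ_four, Matrix.diagonal] at this
  linarith

lemma lorentz_col {L : Matrix (Fin 4) (Fin 4) ℝ} (h : Lᵀ * metric * L = metric) :
    L 0 0 ^ 2 = 1 + (L 1 0 ^ 2 + L 2 0 ^ 2 + L 3 0 ^ 2) := by
  have := congrFun (congrFun h 0) 0
  simp [metric, Matrix.mul_apply, Fin.sum_univ_four, Matrix.diagonal] at this
  linarith

lemma cone_pairing_nonneg {u₀ u₁ u₂ u₃ v₀ v₁ v₂ v₃ : ℝ} (hu : 0 ≤ u₀) (hv : 0 ≤ v₀)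
    (hu' : u₁ ^ 2 + u₂ ^ 2 + u₃ ^ 2 ≤ u₀ ^ 2) (hv' : v₁ ^ 2 + v₂ ^ 2 + v₃ ^ 2 ≤ v₀ ^ 2) :
    0 ≤ u₀ * v₀ + u₁ * v₁ + u₂ * v₂ + u₃ * v₃ := by
  have hcs : (u₁ * v₁ + u₂ * v₂ + u₃ * v₃) ^ 2 ≤
      (u₁ ^ 2 + u₂ ^ 2 + u₃ ^ 2) * (v₁ ^ 2 + v₂ ^ 2 + v₃ ^ 2) := by
    nlinarith [sq_nonneg (u₁ * v₂ - u₂ * v₁), sq_nonneg (u₁ * v₃ - u₃ * v₁),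
      sq_nonneg (u₂ * v₃ - u₃ * v₂)]
  have hle : (u₁ ^ 2 + u₂ ^ 2 + u₃ ^ 2) * (v₁ ^ 2 + v₂ ^ 2 + v₃ ^ 2) ≤ u₀ ^ 2 * v₀ ^ 2 :=
    mul_le_mul hu' hv' (by positivity) (by positivity)
  have := abs_le_of_sq_le_sq' (a := u₁ * v₁ + u₂ * v₂ + u₃ * v₃) (b := u₀ * v₀)
    (by rw [mul_pow]; exact hcs.trans hle) (mul_nonneg hu hv)
  linarith [this.1]

/-- The proper orthochronous Lorentz group `SO⁺(1,3)`: real `4 × 4` matrices of determinant `1`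
that preserve the metric and have positive time-time entry. -/
def SOPlus : Subgroup (Matrix.SpecialLinearGroup (Fin 4) ℝ) where
  carrier := {L | L.1ᵀ * metric * L.1 = metric ∧ 0 < L.1 0 0}
  one_mem' := by simp
  mul_mem' := by
    rintro L M ⟨hL, hL0⟩ ⟨hM, hM0⟩
    have hLM : (L * M).1ᵀ * metric * (L * M).1 = metric := by
      rw [Matrix.SpecialLinearGroup.coe_mul, Matrix.transpose_mul]
      calc M.1ᵀ * L.1ᵀ * metric * (L.1 * M.1) = M.1ᵀ * (L.1ᵀ * metric * L.1) * M.1 := by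
            simp only [Matrix.mul_assoc]
        _ = metric := by rw [hL, hM]
    refine ⟨hLM, ?_⟩
    have hr := lorentz_row hL
    have hc := lorentz_col hM
    have hn : 0 ≤ (L * M).1 0 0 := by
      have := cone_pairing_nonneg (u₁ := L.1 0 1) (u₂ := L.1 0 2) (u₃ := L.1 0 3)
        (v₁ := M.1 1 0) (v₂ := M.1 2 0) (v₃ := M.1 3 0) hL0.le hM0.le (by linarith) (by linarith)
      simpa [Matrix.mul_apply, Fin.sum_univ_four] using this
    have h1 := lorentz_row hLM
    refine lt_of_le_of_ne hn fun h => ?_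
    rw [← h] at h1
    nlinarith [sq_nonneg ((L * M).1 0 1), sq_nonneg ((L * M).1 0 2), sq_nonneg ((L * M).1 0 3)]
  inv_mem' := by
    rintro L ⟨hL, hL0⟩
    have h1 : (metric * L.1ᵀ * metric) * L.1 = 1 := by
      rw [Matrix.mul_assoc, Matrix.mul_assoc, ← Matrix.mul_assoc L.1ᵀ, hL, metric_mul_metric]
    have h2 : (L⁻¹).1 = metric * L.1ᵀ * metric := by
      have h3 : L.1 * (L⁻¹).1 = 1 := by
        rw [← Matrix.SpecialLinearGroup.coe_mul, mul_inv_cancel, Matrix.SpecialLinearGroup.coe_one]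
      exact (left_inv_eq_right_inv h1 h3).symm
    have hη : metricᵀ = metric := by simp [metric]
    refine ⟨?_, ?_⟩
    · rw [h2]
      simp only [Matrix.transpose_mul, Matrix.transpose_transpose, hη]
      calc metric * (L.1 * metric) * metric * (metric * L.1ᵀ * metric)
          = metric * (L.1 * metric * (metric * metric) * L.1ᵀ) * metric := by
            simp only [Matrix.mul_assoc]
        _ = metric := by
            rw [metric_mul_metric, Matrix.mul_one, lorentz_transpose hL, metric_mul_metric,
              Matrix.one_mul]
    · rw [h2]
      simpa [metric, Matrix.mul_apply, Fin.sum_univ_four, Matrix.diagonal] using hL0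

lemma mulVec_mem_forwardCone (L : SOPlus) {x : FourVector} (hx : x ∈ forwardCone) :
    L.1.1 *ᵥ x ∈ forwardCone := by
  rw [mem_forwardCone_iff] at hx ⊢
  obtain ⟨hL, hL0⟩ := L.2
  have hr := lorentz_row hL
  obtain ⟨h0, h⟩ := hx
  constructor
  · have h' : x 1 ^ 2 + x 2 ^ 2 + x 3 ^ 2 ≤ x 0 ^ 2 := by
      simp only [msq, mdot] at h
      nlinarith
    have := cone_pairing_nonneg (u₁ := L.1.1 0 1) (u₂ := L.1.1 0 2) (u₃ := L.1.1 0 3)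
      hL0.le h0 (by linarith) h'
    simpa [Matrix.mulVec, dotProduct, Fin.sum_univ_four] using this
  · have : msq (L.1.1 *ᵥ x) = msq x := by
      have h1 : x ⬝ᵥ (metric *ᵥ x) = x ⬝ᵥ ((L.1.1ᵀ * metric * L.1.1) *ᵥ x) := by rw [hL]
      rw [msq, msq, mdot_eq, mdot_eq, h1]
      simp only [← Matrix.mulVec_mulVec, Matrix.dotProduct_mulVec, Matrix.vecMul_transpose]
    rw [this]
    exact h

/-- A momentum: a forward-time-directed non-spacelike four-vector. -/
abbrev Momentum : Type := forwardCone

instance : MulAction SOPlus Momentum where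
  smul L x := ⟨L.1.1 *ᵥ x.1, mulVec_mem_forwardCone L x.2⟩
  one_smul x := Subtype.ext (by
    change (1 : Matrix (Fin 4) (Fin 4) ℝ) *ᵥ x.1 = x.1
    exact Matrix.one_mulVec _)
  mul_smul L M x := Subtype.ext (by
    change (L.1 * M.1).1 *ᵥ x.1 = L.1.1 *ᵥ (M.1.1 *ᵥ x.1)
    rw [Matrix.SpecialLinearGroup.coe_mul, Matrix.mulVec_mulVec])

/-- The momenta `(p, q, a, b, c)` of an event of the class `(pq) → (abc) + X`. -/
abbrev Event : Type := (Fin 2 → Momentum) × (Fin 3 → Momentum)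

/-- The symmetry group `SO⁺(1,3) × S₂(pq) × S₃(abc)`. -/
abbrev SymmetryGroup : Type := SOPlus × Equiv.Perm (Fin 2) × Equiv.Perm (Fin 3)

/-- The Lorentz group acts on all momenta simultaneously; the permutations permute `(p, q)` and
`(a, b, c)` respectively. -/
instance : MulAction SymmetryGroup Event where
  smul g x := (fun i => g.1 • x.1 (g.2.1⁻¹ i), fun j => g.1 • x.2 (g.2.2⁻¹ j))
  one_smul x := by
    refine Prod.ext (funext fun i => ?_) (funext fun j => ?_)
    · exact one_smul SOPlus (x.1 i)
    · exact one_smul SOPlus (x.2 j)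
  mul_smul g h x := by
    refine Prod.ext (funext fun i => ?_) (funext fun j => ?_)
    · change (g.1 * h.1) • x.1 ((g.2.1 * h.2.1)⁻¹ i) = g.1 • h.1 • x.1 (h.2.1⁻¹ (g.2.1⁻¹ i))
      rw [mul_smul, mul_inv_rev, Equiv.Perm.mul_apply]
    · change (g.1 * h.1) • x.2 ((g.2.2 * h.2.2)⁻¹ j) = g.1 • h.1 • x.2 (h.2.2⁻¹ (g.2.2⁻¹ j))
      rw [mul_smul, mul_inv_rev, Equiv.Perm.mul_apply]

/-- Parity `(E, p) ↦ (E, -p)` on a momentum (here `p` is the spatial part). -/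
def Momentum.parity (x : Momentum) : Momentum :=
  ⟨![x.1 0, -x.1 1, -x.1 2, -x.1 3], by
    have hx := (mem_forwardCone_iff x.1).mp x.2
    rw [mem_forwardCone_iff]
    simpa [msq, mdot] using hx⟩

/-- Parity on an event, acting on every momentum. -/
def Event.parity (e : Event) : Event :=
  (fun i => (e.1 i).parity, fun j => (e.2 j).parity)

/-- Two events are equivalent if an element of the symmetry group maps one to the other. -/
def Event.Equivalent (e f : Event) : Prop := ∃ g : SymmetryGroup, e = g • f

/-- An event is chiral if it is not equivalent to its parity image. -/
def Event.IsChiral (e : Event) : Prop := ¬ Event.Equivalent e e.parity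

/-- The event with momenta `p, q, a, b, c`. -/
def mkEvent (p q a b c : Momentum) : Event := (![p, q], ![a, b, c])

/-- Collision events: `p² q² < (p.q)²`, where `p, q` are the two momenta of the first class. -/
def Event.IsCollision (e : Event) : Prop :=
  msq (e.1 0) * msq (e.1 1) < mdot (e.1 0) (e.1 1) ^ 2

/-- The explicit condition `C`, a Boolean combination of (non-)vanishing of brackets `[x,y,p,q]`,
Gram determinants and mass differences. -/
def ConditionC (p q a b c : FourVector) : Prop :=
  (bracket a b p q ≠ 0 ∨ bracket b c p q ≠ 0 ∨ bracket c a p q ≠ 0)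
  ∧
  ((msq a ≠ msq b ∨ gramTwo (a - b) (p + q) (p - q) (p + q) ≠ 0 ∨
      gramTwo (a - b) (p + q) (a + b) (p + q) ≠ 0 ∨
      gramTwo (a - b) (p + q) (a + b + c) (p + q) ≠ 0 ∨ a = b) ∧
    (msq b ≠ msq c ∨ gramTwo (b - c) (p + q) (p - q) (p + q) ≠ 0 ∨
      gramTwo (b - c) (p + q) (b + c) (p + q) ≠ 0 ∨
      gramTwo (b - c) (p + q) (a + b + c) (p + q) ≠ 0 ∨ b = c) ∧
    (msq c ≠ msq a ∨ gramTwo (c - a) (p + q) (p - q) (p + q) ≠ 0 ∨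
      gramTwo (c - a) (p + q) (c + a) (p + q) ≠ 0 ∨
      gramTwo (c - a) (p + q) (a + b + c) (p + q) ≠ 0 ∨ c = a))
  ∧
  (msq p ≠ msq q ∨ gramTwo a (p + q) (p - q) (p + q) ≠ 0 ∨
    gramTwo b (p + q) (p - q) (p + q) ≠ 0 ∨ gramTwo c (p + q) (p - q) (p + q) ≠ 0)
  ∧
  (msq p ≠ msq q ∨ gramTwo (a + b + c) (p + q) (p - q) (p + q) ≠ 0 ∨
    ((msq a ≠ msq b ∨ gramTwo (a + b) (p + q) (p - q) (p + q) ≠ 0 ∨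
        symGramThree (a - b) p q ≠ 0) ∧
      (msq b ≠ msq c ∨ gramTwo (b + c) (p + q) (p - q) (p + q) ≠ 0 ∨
        symGramThree (b - c) p q ≠ 0) ∧
      (msq c ≠ msq a ∨ gramTwo (c + a) (p + q) (p - q) (p + q) ≠ 0 ∨
        symGramThree (c - a) p q ≠ 0)))

end Collider

end

open Collider

open scoped Matrix

noncomputable section

namespace Collider

/-! ### Algebra of the Lorentz product, Gram determinants and bracket. -/

section Bilinear

variable (x y z w : FourVector) (r : ℝ)

/-! Composing parity with the proper orthochronous group gives exactly the improper orthochronous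
transformations, so an event is non-chiral iff some such `M` permutes `p, q` among themselves and
`a, b, c` among themselves. `M` preserves Lorentz products and negates brackets.

Given `M`, the type of permutation decides which clause of `C` fails. With `p, q` fixed, the
identity and the 3-cycles kill all brackets (clause 1), and a transposition violates clause 2, or
clause 1 if the exchanged momenta coincide. With `p, q` exchanged, the identity and the 3-cycles
violate clause 3, a transposition clause 4 or clause 1.

Conversely, each failing clause supplies a vector `v` whose hyperplane reflection is the required
`M`: a common normal of all momenta (clause 1), the difference of two outgoing momenta (clause 2),
or `p - q` (clauses 3 and 4). The collision condition makes `P = p + q` timelike. Every such `v` is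
nonzero and orthogonal to `P`, hence spacelike, so its reflection is orthochronous. For timelike
`P`, `G(x, P; y, P)` is `P²` times the product of the components of `x, y` orthogonal to `P`. -/

lemma mdot_comm : mdot x y = mdot y x := by simp only [mdot]; ring

lemma mdot_add_left : mdot (x + y) z = mdot x z + mdot y z := by
  simp only [mdot, Pi.add_apply]; ring

lemma mdot_add_right : mdot z (x + y) = mdot z x + mdot z y := by
  simp only [mdot, Pi.add_apply]; ring

lemma mdot_sub_left : mdot (x - y) z = mdot x z - mdot y z := by
  simp only [mdot, Pi.sub_apply]; ring

lemma mdot_sub_right : mdot z (x - y) = mdot z x - mdot z y := by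
  simp only [mdot, Pi.sub_apply]; ring

lemma mdot_smul_left : mdot (r • x) z = r * mdot x z := by
  simp only [mdot, Pi.smul_apply, smul_eq_mul]; ring

lemma mdot_smul_right : mdot z (r • x) = r * mdot z x := by
  simp only [mdot, Pi.smul_apply, smul_eq_mul]; ring

lemma gramTwo_eq (x₁ x₂ y₁ y₂ : FourVector) :
    gramTwo x₁ x₂ y₁ y₂ = mdot x₁ y₁ * mdot x₂ y₂ - mdot x₁ y₂ * mdot x₂ y₁ := by
  simp [gramTwo, Matrix.det_fin_two]

lemma symGramThree_eq : symGramThree x y z =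
    mdot x x * (mdot y y * mdot z z - mdot y z ^ 2)
      - mdot x y * (mdot x y * mdot z z - mdot y z * mdot x z)
      + mdot x z * (mdot x y * mdot y z - mdot y y * mdot x z) := by
  simp only [symGramThree, Matrix.det_fin_three, Matrix.of_apply, Matrix.cons_val]
  rw [mdot_comm y x, mdot_comm z x, mdot_comm z y]
  ring

lemma bracket_eq : bracket x y z w =
    (x 0 * y 1 - x 1 * y 0) * (z 2 * w 3 - z 3 * w 2)
      - (x 0 * y 2 - x 2 * y 0) * (z 1 * w 3 - z 3 * w 1)
      + (x 0 * y 3 - x 3 * y 0) * (z 1 * w 2 - z 2 * w 1)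
      + (x 1 * y 2 - x 2 * y 1) * (z 0 * w 3 - z 3 * w 0)
      - (x 1 * y 3 - x 3 * y 1) * (z 0 * w 2 - z 2 * w 0)
      + (x 2 * y 3 - x 3 * y 2) * (z 0 * w 1 - z 1 * w 0) := by
  rw [bracket, Matrix.det_succ_row_zero]
  simp [Fin.sum_univ_four, Matrix.det_fin_three, Fin.succAbove]
  ring

lemma bracket_swap_left : bracket y x z w = -bracket x y z w := by
  simp only [bracket_eq]; ring

lemma bracket_swap_right : bracket x y w z = -bracket x y z w := by
  simp only [bracket_eq]; ring

lemma bracket_self_left : bracket x x z w = 0 := by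
  simp only [bracket_eq]; ring

lemma bracket_mulVec (M : Matrix (Fin 4) (Fin 4) ℝ) :
    bracket (M *ᵥ x) (M *ᵥ y) (M *ᵥ z) (M *ᵥ w) = M.det * bracket x y z w := by
  have h : Matrix.of ![M *ᵥ x, M *ᵥ y, M *ᵥ z, M *ᵥ w] = Matrix.of ![x, y, z, w] * Mᵀ := by
    ext i j
    fin_cases i <;> simp [Matrix.mul_apply, Matrix.mulVec, dotProduct, mul_comm]
  rw [bracket, h, Matrix.det_mul, Matrix.det_transpose, mul_comm, bracket]

/-- Cramer's rule for the expansion of a vector in four others. -/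
lemma bracket_cramer (u : FourVector) : bracket x y z w • u =
    bracket u y z w • x + bracket x u z w • y + bracket x y u w • z + bracket x y z u • w := by
  ext i
  simp only [bracket_eq, Pi.add_apply, Pi.smul_apply, smul_eq_mul]
  fin_cases i <;> simp <;> ring

end Bilinear

/-! ### Causal geometry of the forward cone. -/

section Cone

variable {x y P v : FourVector}

lemma mdot_nonneg_of_mem (hx : x ∈ forwardCone) (hy : y ∈ forwardCone) : 0 ≤ mdot x y := by
  obtain ⟨hx0, hx⟩ := (mem_forwardCone_iff x).1 hx
  obtain ⟨hy0, hy⟩ := (mem_forwardCone_iff y).1 hy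
  simp only [msq, mdot] at hx hy
  have := cone_pairing_nonneg (u₁ := x 1) (u₂ := x 2) (u₃ := x 3)
    (v₁ := -y 1) (v₂ := -y 2) (v₃ := -y 3) hx0 hy0 (by linarith) (by linarith)
  simp only [mdot]
  linarith

/-- A nonzero vector orthogonal to a timelike vector is spacelike. -/
lemma msq_neg_of_orthogonal (hP : 0 < msq P) (h : mdot v P = 0) (hv : v ≠ 0) : msq v < 0 := by
  by_contra! hn
  simp only [msq, mdot] at hP h hn
  have h1 : v 0 * P 0 = v 1 * P 1 + v 2 * P 2 + v 3 * P 3 := by linarith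
  -- Cauchy–Schwarz on the spatial parts; with `v² ≥ 0` it yields `(v⁰)² P² ≤ 0`, so `v⁰ = 0` and
  -- then `v = 0`.
  have hcs : (v 0 * P 0) ^ 2 ≤
      (v 1 ^ 2 + v 2 ^ 2 + v 3 ^ 2) * (P 1 ^ 2 + P 2 ^ 2 + P 3 ^ 2) := by
    rw [h1]
    nlinarith [sq_nonneg (v 1 * P 2 - v 2 * P 1), sq_nonneg (v 1 * P 3 - v 3 * P 1),
      sq_nonneg (v 2 * P 3 - v 3 * P 2)]
  have hle : (v 1 ^ 2 + v 2 ^ 2 + v 3 ^ 2) * (P 1 ^ 2 + P 2 ^ 2 + P 3 ^ 2) ≤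
      v 0 ^ 2 * (P 1 ^ 2 + P 2 ^ 2 + P 3 ^ 2) :=
    mul_le_mul_of_nonneg_right (by linarith) (by positivity)
  have h0 : v 0 ^ 2 * (P 0 * P 0 - P 1 * P 1 - P 2 * P 2 - P 3 * P 3) ≤ 0 := by linarith
  have h00 : v 0 ^ 2 = 0 :=
    le_antisymm (nonpos_of_mul_nonpos_left h0 hP) (sq_nonneg _)
  refine hv (funext fun i => ?_)
  have hs : ∀ t : ℝ, t ^ 2 ≤ 0 → t = 0 := fun t ht => pow_eq_zero_iff two_ne_zero |>.1
    (le_antisymm ht (sq_nonneg t))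
  fin_cases i <;> refine hs _ ?_ <;> simp <;>
    nlinarith [sq_nonneg (v 1), sq_nonneg (v 2), sq_nonneg (v 3)]

lemma eq_zero_of_mem_of_orthogonal (hP : 0 < msq P) (hx : x ∈ forwardCone)
    (h : mdot x P = 0) : x = 0 := by
  by_contra hne
  exact absurd ((mem_forwardCone_iff x).1 hx).2 (msq_neg_of_orthogonal hP h hne).not_ge

/-- Two nonnegative products with `P` sum to zero, so both vectors are zero. This disposes of the
degenerate factor `(a + b)·P = 0` later on. -/
lemma eq_of_mem_of_add_orthogonal (hP : 0 < msq P) (hPc : P ∈ forwardCone)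
    (hx : x ∈ forwardCone) (hy : y ∈ forwardCone) (h : mdot (x + y) P = 0) : x = y := by
  rw [mdot_add_left] at h
  have h1 := mdot_nonneg_of_mem hx hPc
  have h2 := mdot_nonneg_of_mem hy hPc
  rw [eq_zero_of_mem_of_orthogonal hP hx (by linarith),
    eq_zero_of_mem_of_orthogonal hP hy (by linarith)]

lemma msq_add_pos (hx : x ∈ forwardCone) (hy : y ∈ forwardCone)
    (h : msq x * msq y < mdot x y ^ 2) : 0 < msq (x + y) := by
  have h1 := ((mem_forwardCone_iff x).1 hx).2
  have h2 := ((mem_forwardCone_iff y).1 hy).2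
  have h3 := mdot_nonneg_of_mem hx hy
  have h4 : 0 < mdot x y := by
    refine lt_of_le_of_ne h3 fun h0 => ?_
    rw [← h0] at h
    nlinarith [mul_nonneg h1 h2]
  have : msq (x + y) = msq x + msq y + 2 * mdot x y := by
    simp only [msq, mdot, Pi.add_apply]; ring
  linarith

lemma add_mem_forwardCone (hx : x ∈ forwardCone) (hy : y ∈ forwardCone) :
    x + y ∈ forwardCone := by
  have hxy := mdot_nonneg_of_mem hx hy
  rw [mem_forwardCone_iff] at *
  have : msq (x + y) = msq x + msq y + 2 * mdot x y := by
    simp only [msq, mdot, Pi.add_apply]; ring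
  exact ⟨add_nonneg hx.1 hy.1, by linarith⟩

end Cone

/-! ### Reduction of chirality to improper symmetries. -/

/-- The improper orthochronous Lorentz transformations. -/
def IsImproper (M : Matrix (Fin 4) (Fin 4) ℝ) : Prop :=
  Mᵀ * metric * M = metric ∧ M.det = -1 ∧ 0 < M 0 0

lemma det_metric : metric.det = -1 := by
  simp [metric, Fin.prod_univ_four]

lemma IsImproper.mdot_mulVec {M : Matrix (Fin 4) (Fin 4) ℝ} (hM : IsImproper M)
    (x y : FourVector) : mdot (M *ᵥ x) (M *ᵥ y) = mdot x y := by
  have h1 : x ⬝ᵥ (metric *ᵥ y) = x ⬝ᵥ ((Mᵀ * metric * M) *ᵥ y) := by rw [hM.1]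
  rw [mdot_eq, mdot_eq, h1]
  simp only [← Matrix.mulVec_mulVec, Matrix.dotProduct_mulVec, Matrix.vecMul_transpose]

lemma IsImproper.bracket_mulVec {M : Matrix (Fin 4) (Fin 4) ℝ} (hM : IsImproper M)
    (x y z w : FourVector) :
    bracket (M *ᵥ x) (M *ᵥ y) (M *ᵥ z) (M *ᵥ w) = -bracket x y z w := by
  rw [Collider.bracket_mulVec, hM.2.1, neg_one_mul]

lemma metric_mulVec (x : FourVector) : metric *ᵥ x = ![x 0, -x 1, -x 2, -x 3] := by
  ext i
  fin_cases i <;> simp [metric, Matrix.mulVec_diagonal]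

lemma isImproper_mul_metric {L : Matrix.SpecialLinearGroup (Fin 4) ℝ} (hL : L ∈ SOPlus) :
    IsImproper (L.1 * metric) := by
  refine ⟨?_, ?_, ?_⟩
  · have hη : metricᵀ = metric := by simp [metric]
    rw [Matrix.transpose_mul, hη]
    calc metric * L.1ᵀ * metric * (L.1 * metric)
        = metric * (L.1ᵀ * metric * L.1) * metric := by simp only [Matrix.mul_assoc]
      _ = metric := by rw [hL.1, metric_mul_metric, Matrix.one_mul]
  · rw [Matrix.det_mul, L.2, det_metric, one_mul]
  · simpa [metric] using hL.2

lemma exists_SOPlus_of_isImproper {M : Matrix (Fin 4) (Fin 4) ℝ} (hM : IsImproper M) :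
    ∃ L : SOPlus, L.1.1 * metric = M := by
  refine ⟨⟨⟨M * metric, by rw [Matrix.det_mul, hM.2.1, det_metric]; norm_num⟩, ?_, ?_⟩, ?_⟩
  · have hη : metricᵀ = metric := by simp [metric]
    change (M * metric)ᵀ * metric * (M * metric) = metric
    rw [Matrix.transpose_mul, hη]
    calc metric * Mᵀ * metric * (M * metric)
        = metric * (Mᵀ * metric * M) * metric := by simp only [Matrix.mul_assoc]
      _ = metric := by rw [hM.1, metric_mul_metric, Matrix.one_mul]
  · change 0 < (M * metric) 0 0
    simpa [metric] using hM.2.2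
  · change M * metric * metric = M
    rw [Matrix.mul_assoc, metric_mul_metric, Matrix.mul_one]

/-- Some improper orthochronous Lorentz transformation permutes `p, q` and permutes `a, b, c`. -/
def HasImproperSymmetry (p q a b c : FourVector) : Prop :=
  ∃ M, IsImproper M ∧ (M *ᵥ p = p ∧ M *ᵥ q = q ∨ M *ᵥ p = q ∧ M *ᵥ q = p) ∧
    (M *ᵥ a = a ∧ M *ᵥ b = b ∧ M *ᵥ c = c ∨
      M *ᵥ a = b ∧ M *ᵥ b = a ∧ M *ᵥ c = c ∨
      M *ᵥ b = c ∧ M *ᵥ c = b ∧ M *ᵥ a = a ∨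
      M *ᵥ c = a ∧ M *ᵥ a = c ∧ M *ᵥ b = b ∨
      M *ᵥ a = b ∧ M *ᵥ b = c ∧ M *ᵥ c = a ∨
      M *ᵥ b = a ∧ M *ᵥ c = b ∧ M *ᵥ a = c)

/-- With `ConditionC.rotate`, this reduces every argument about a pair of outgoing momenta to the
pair `(a, b)`. -/
lemma HasImproperSymmetry.rotate {p q a b c : FourVector} (h : HasImproperSymmetry p q a b c) :
    HasImproperSymmetry p q b c a := by
  obtain ⟨M, hM, h1, h2⟩ := h
  refine ⟨M, hM, h1, ?_⟩
  rcases h2 with ⟨ha, hb, hc⟩ | h | h | h | ⟨ha, hb, hc⟩ | ⟨hb, hc, ha⟩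
  · exact .inl ⟨hb, hc, ha⟩
  · exact .inr (.inr (.inr (.inl h)))
  · exact .inr (.inl h)
  · exact .inr (.inr (.inl h))
  · exact .inr (.inr (.inr (.inr (.inl ⟨hb, hc, ha⟩))))
  · exact .inr (.inr (.inr (.inr (.inr ⟨hc, ha, hb⟩))))

/-- Parity is the matrix `metric`, and right multiplication by it is a bijection between `SOPlus`
and the improper orthochronous matrices. -/
lemma equivalent_parity_iff (e : Event) : Event.Equivalent e e.parity ↔
    ∃ M, IsImproper M ∧ ∃ (σ : Equiv.Perm (Fin 2)) (τ : Equiv.Perm (Fin 3)),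
      (∀ i, M *ᵥ (e.1 i).1 = (e.1 (σ i)).1) ∧ ∀ j, M *ᵥ (e.2 j).1 = (e.2 (τ j)).1 := by
  have key : ∀ (L : SOPlus) (x : Momentum),
      (L • x.parity).1 = (L.1.1 * metric) *ᵥ x.1 := fun L x => by
    rw [← Matrix.mulVec_mulVec, metric_mulVec]
    rfl
  constructor
  · rintro ⟨⟨L, σ, τ⟩, h⟩
    refine ⟨L.1.1 * metric, isImproper_mul_metric L.2, σ, τ, fun i => ?_, fun j => ?_⟩
    · have : e.1 (σ i) = L • (e.1 (σ⁻¹ (σ i))).parity := congrFun (congrArg Prod.fst h) (σ i)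
      rw [this, key, Equiv.Perm.inv_def, Equiv.symm_apply_apply]
    · have : e.2 (τ j) = L • (e.2 (τ⁻¹ (τ j))).parity := congrFun (congrArg Prod.snd h) (τ j)
      rw [this, key, Equiv.Perm.inv_def, Equiv.symm_apply_apply]
  · rintro ⟨M, hM, σ, τ, h1, h2⟩
    obtain ⟨L, rfl⟩ := exists_SOPlus_of_isImproper hM
    refine ⟨(L, σ, τ), Prod.ext (funext fun i => Subtype.ext ?_)
      (funext fun j => Subtype.ext ?_)⟩
    · change (e.1 i).1 = (L • (e.1 (σ⁻¹ i)).parity).1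
      rw [key, h1, Equiv.Perm.inv_def, Equiv.apply_symm_apply]
    · change (e.2 j).1 = (L • (e.2 (τ⁻¹ j)).parity).1
      rw [key, h2, Equiv.Perm.inv_def, Equiv.apply_symm_apply]

lemma perm_fin_two_cases (σ : Equiv.Perm (Fin 2)) :
    σ 0 = 0 ∧ σ 1 = 1 ∨ σ 0 = 1 ∧ σ 1 = 0 := by
  revert σ; decide

lemma perm_fin_three_cases (τ : Equiv.Perm (Fin 3)) :
    τ 0 = 0 ∧ τ 1 = 1 ∧ τ 2 = 2 ∨ τ 0 = 1 ∧ τ 1 = 0 ∧ τ 2 = 2 ∨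
    τ 1 = 2 ∧ τ 2 = 1 ∧ τ 0 = 0 ∨ τ 2 = 0 ∧ τ 0 = 2 ∧ τ 1 = 1 ∨
    τ 0 = 1 ∧ τ 1 = 2 ∧ τ 2 = 0 ∨ τ 1 = 0 ∧ τ 2 = 1 ∧ τ 0 = 2 := by
  revert τ; decide

lemma equivalent_parity_mkEvent_iff (p q a b c : Momentum) :
    Event.Equivalent (mkEvent p q a b c) (mkEvent p q a b c).parity ↔
      HasImproperSymmetry p q a b c := by
  rw [equivalent_parity_iff]
  constructor
  · rintro ⟨M, hM, σ, τ, h1, h2⟩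
    have hp := h1 0
    have hq := h1 1
    have ha := h2 0
    have hb := h2 1
    have hc := h2 2
    refine ⟨M, hM, ?_, ?_⟩
    · rcases perm_fin_two_cases σ with ⟨s, t⟩ | ⟨s, t⟩ <;> rw [s] at hp <;> rw [t] at hq
      · exact .inl ⟨hp, hq⟩
      · exact .inr ⟨hp, hq⟩
    · rcases perm_fin_three_cases τ with h | h | h | h | h | h <;> obtain ⟨r, s, t⟩ := h <;>
        simp only [r, s, t] at ha hb hc
      · exact .inl ⟨ha, hb, hc⟩
      · exact .inr (.inl ⟨ha, hb, hc⟩)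
      · exact .inr (.inr (.inl ⟨hb, hc, ha⟩))
      · exact .inr (.inr (.inr (.inl ⟨hc, ha, hb⟩)))
      · exact .inr (.inr (.inr (.inr (.inl ⟨ha, hb, hc⟩))))
      · exact .inr (.inr (.inr (.inr (.inr ⟨hb, hc, ha⟩))))
  · rintro ⟨M, hM, h1, h2⟩
    have hσ : ∃ σ : Equiv.Perm (Fin 2), ∀ i, M *ᵥ ((mkEvent p q a b c).1 i).1 =
        ((mkEvent p q a b c).1 (σ i)).1 := by
      rcases h1 with h1 | h1
      · exact ⟨1, Fin.forall_fin_two.2 h1⟩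
      · exact ⟨Equiv.swap 0 1, Fin.forall_fin_two.2 h1⟩
    have hτ : ∃ τ : Equiv.Perm (Fin 3), ∀ j, M *ᵥ ((mkEvent p q a b c).2 j).1 =
        ((mkEvent p q a b c).2 (τ j)).1 := by
      have hall : ∀ {Q : Fin 3 → Prop}, Q 0 → Q 1 → Q 2 → ∀ j, Q j := fun h0 h1 h2 j => by
        fin_cases j <;> assumption
      rcases h2 with h | h | h | h | h | h <;> obtain ⟨r, s, t⟩ := h
      · exact ⟨1, hall r s t⟩
      · exact ⟨Equiv.swap 0 1, hall r s t⟩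
      · exact ⟨Equiv.swap 1 2, hall t r s⟩
      · exact ⟨Equiv.swap 2 0, hall s t r⟩
      · exact ⟨finRotate 3, hall r s t⟩
      · exact ⟨(finRotate 3)⁻¹, hall t r s⟩
    obtain ⟨σ, hσ⟩ := hσ
    obtain ⟨τ, hτ⟩ := hτ
    exact ⟨M, hM, σ, τ, hσ, hτ⟩

/-! ### Hyperplane reflections. -/

/-- The reflection in the hyperplane orthogonal to `v`. -/
def hyperplaneReflection (v : FourVector) : Matrix (Fin 4) (Fin 4) ℝ :=
  1 - (2 / msq v) • Matrix.vecMulVec v (metric *ᵥ v)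

lemma hyperplaneReflection_mulVec (v x : FourVector) :
    hyperplaneReflection v *ᵥ x = x - (2 * mdot x v / msq v) • v := by
  rw [hyperplaneReflection, Matrix.sub_mulVec, Matrix.one_mulVec, Matrix.smul_mulVec,
    Matrix.vecMulVec_mulVec, dotProduct_comm, ← mdot_eq]
  ext i
  simp only [Pi.sub_apply, Pi.smul_apply, smul_eq_mul, MulOpposite.smul_eq_mul_unop,
    MulOpposite.unop_op]
  ring

lemma isImproper_hyperplaneReflection {v : FourVector} (hv : msq v < 0) :
    IsImproper (hyperplaneReflection v) := by
  have hv' : msq v ≠ 0 := hv.ne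
  refine ⟨?_, ?_, ?_⟩
  · have hb : ∀ x y, mdot (hyperplaneReflection v *ᵥ x) (hyperplaneReflection v *ᵥ y) =
        mdot x y := fun x y => by
      simp only [hyperplaneReflection_mulVec, mdot_sub_left, mdot_sub_right, mdot_smul_left,
        mdot_smul_right, mdot_comm v y]
      change _ - _ * (_ - _ * msq v) = _
      field_simp
      ring
    refine Matrix.ext_of_single_vecMul fun i => ?_
    refine funext fun j => ?_
    have h := hb (Pi.single i 1) (Pi.single j 1)
    rw [mdot_eq, mdot_eq, ← Matrix.vecMul_transpose, ← Matrix.dotProduct_mulVec,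
      Matrix.mulVec_mulVec, Matrix.mulVec_mulVec] at h
    simpa [Matrix.mul_assoc] using h
  -- A rank-one perturbation of the identity, so the determinant is `1 - 2 = -1`.
  · have h1 : hyperplaneReflection v = 1 + Matrix.replicateCol Unit (-(2 / msq v) • v) *
        Matrix.replicateRow Unit (metric *ᵥ v) := by
      rw [hyperplaneReflection, ← Matrix.vecMulVec_eq, Matrix.smul_vecMulVec, neg_smul,
        sub_eq_add_neg]
    rw [h1, Matrix.det_one_add_replicateCol_mul_replicateRow, dotProduct_smul, dotProduct_comm,
      ← mdot_eq]
    change 1 + -(2 / msq v) * msq v = -1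
    field_simp
    norm_num
  · have : hyperplaneReflection v 0 0 = 1 + 2 / (-msq v) * v 0 ^ 2 := by
      simp [hyperplaneReflection, metric_mulVec, div_neg]
      ring
    rw [this]
    have : 0 < 2 / (-msq v) := div_pos two_pos (neg_pos.2 hv)
    positivity

lemma hyperplaneReflection_of_orthogonal {v x : FourVector} (h : mdot x v = 0) :
    hyperplaneReflection v *ᵥ x = x := by
  simp [hyperplaneReflection_mulVec, h]

/-- The reflection negates `x - y`, parallel to `v`, and fixes `x + y`, orthogonal to `v`. The value
`s = 0`, i.e. `x = y`, is allowed and is needed for clause 4. -/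
lemma hyperplaneReflection_eq {v x y : FourVector} {s : ℝ} (hv : msq v ≠ 0)
    (hxy : x - y = s • v) (h : mdot (x + y) v = 0) : hyperplaneReflection v *ᵥ x = y := by
  have h1 : mdot (x - y) v = s * msq v := by rw [hxy, mdot_smul_left, msq]
  rw [mdot_add_left] at h
  rw [mdot_sub_left] at h1
  have h2 : 2 * mdot x v / msq v = s := by
    field_simp
    linarith
  rw [hyperplaneReflection_mulVec, h2, ← hxy, sub_sub_cancel]

lemma hyperplaneReflection_eq_symm {v x y : FourVector} {s : ℝ} (hv : msq v ≠ 0)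
    (hxy : x - y = s • v) (h : mdot (x + y) v = 0) : hyperplaneReflection v *ᵥ y = x :=
  hyperplaneReflection_eq (s := -s) hv (by rw [neg_smul, ← hxy, neg_sub]) (by rwa [add_comm])

lemma ConditionC.rotate {p q a b c : FourVector} (h : ConditionC p q a b c) :
    ConditionC p q b c a := by
  have h1 : b + c + a = a + b + c := by abel
  obtain ⟨hb, ⟨hab, hbc, hca⟩, hK, hs⟩ := h
  have hr : ∀ {Q R S : Prop}, Q ∨ R ∨ S → R ∨ S ∨ Q := fun h => or_assoc.1 h.symm
  rw [← h1] at hab hbc hca hs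
  exact ⟨hr hb, ⟨hbc, hca, hab⟩, hK.imp_right hr,
    hs.imp_right (Or.imp_right fun ⟨u, v, w⟩ => ⟨v, w, u⟩)⟩

lemma mdot_eq_of_mulVec {M : Matrix (Fin 4) (Fin 4) ℝ} (hM : IsImproper M)
    {x y x' y' : FourVector} (hx : M *ᵥ x = x') (hy : M *ᵥ y = y') :
    mdot x' y' = mdot x y := by
  rw [← hx, ← hy, hM.mdot_mulVec]

lemma bracket_eq_of_mulVec {M : Matrix (Fin 4) (Fin 4) ℝ} (hM : IsImproper M)
    {x y z w x' y' z' w' : FourVector} (hx : M *ᵥ x = x') (hy : M *ᵥ y = y')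
    (hz : M *ᵥ z = z') (hw : M *ᵥ w = w') :
    bracket x' y' z' w' = -bracket x y z w := by
  rw [← hx, ← hy, ← hz, ← hw, hM.bracket_mulVec]

/-! ### An improper symmetry violates `C`. -/

section Symmetric

variable {p q a b c : FourVector} {M : Matrix (Fin 4) (Fin 4) ℝ}

lemma not_conditionC_of_transposition (hM : IsImproper M) (hp : M *ᵥ p = p) (hq : M *ᵥ q = q)
    (ha : M *ᵥ a = b) (hb : M *ᵥ b = a) (hc : M *ᵥ c = c) : ¬ ConditionC p q a b c := by
  rintro ⟨h1, ⟨h2, -⟩, -⟩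
  have e1 := mdot_eq_of_mulVec hM ha hp
  have e2 := mdot_eq_of_mulVec hM ha hq
  have e3 := mdot_eq_of_mulVec hM ha hc
  have e4 := mdot_eq_of_mulVec hM ha ha
  have e5 := mdot_comm a b
  rcases h2 with h | h | h | h | h
  · exact h e4.symm
  · refine h ?_
    simp only [gramTwo_eq, mdot_add_left, mdot_add_right, mdot_sub_left, mdot_sub_right]
    rw [e1, e2]; ring
  · refine h ?_
    simp only [gramTwo_eq, mdot_add_left, mdot_add_right, mdot_sub_left]
    rw [e1, e2, e4, e5]; ring
  · refine h ?_
    simp only [gramTwo_eq, mdot_add_left, mdot_add_right, mdot_sub_left]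
    rw [e1, e2, e3, e4, e5]; ring
  -- Now `M` fixes all of `a, c, p, q`, so their bracket equals its own negative.
  · subst h
    have b1 := bracket_eq_of_mulVec hM ha hc hp hq
    have b2 := bracket_eq_of_mulVec hM hc ha hp hq
    rcases h1 with h | h | h
    · exact h (bracket_self_left _ _ _)
    · exact h (by linarith)
    · exact h (by linarith)

/-- If `[a, b, p, q] = 0` and `[b, c, p, q] = [a, c, p, q] ≠ 0`, then `a - b` lies in the span of
`p` and `q`. -/
lemma symGramThree_eq_zero_of_bracket (h1 : bracket a b p q = 0)
    (h2 : bracket b c p q = bracket a c p q) (h : bracket b c p q ≠ 0) :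
    symGramThree (a - b) p q = 0 := by
  have h3 := bracket_cramer b c p q (a - b)
  have h4 : bracket (a - b) c p q = 0 := by
    have : bracket (a - b) c p q = bracket a c p q - bracket b c p q := by
      simp only [bracket_eq, Pi.sub_apply]; ring
    rw [this, h2, sub_self]
  have h5 : bracket b (a - b) p q = 0 := by
    have : bracket b (a - b) p q = -bracket a b p q := by
      simp only [bracket_eq, Pi.sub_apply]; ring
    rw [this, h1, neg_zero]
  rw [h4, h5, zero_smul, zero_smul, zero_add, zero_add] at h3
  generalize bracket b c (a - b) q = r at h3
  generalize bracket b c p (a - b) = s at h3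
  generalize bracket b c p q = t at h h3
  generalize a - b = u at h3
  -- By Cramer's rule `t • u` is a combination of `p` and `q`, and `Δ₃` is quadratic in its first
  -- argument.
  have h6 : t ^ 2 * symGramThree u p q = symGramThree (t • u) p q := by
    simp only [symGramThree_eq, mdot_smul_left, mdot_smul_right]; ring
  have h7 : symGramThree (t • u) p q = 0 := by
    rw [h3]
    simp only [symGramThree_eq, mdot_smul_left, mdot_smul_right, mdot_add_left, mdot_add_right,
      mdot_comm q p]
    ring
  rw [h7] at h6
  exact (mul_eq_zero.1 h6).resolve_left (pow_ne_zero 2 h)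

lemma not_conditionC_of_swap_transposition (hM : IsImproper M) (hp : M *ᵥ p = q)
    (hq : M *ᵥ q = p) (ha : M *ᵥ a = b) (hb : M *ᵥ b = a) (hc : M *ᵥ c = c) :
    ¬ ConditionC p q a b c := by
  rintro ⟨h1, -, -, h4⟩
  have e1 := mdot_eq_of_mulVec hM ha hp
  have e2 := mdot_eq_of_mulVec hM ha hq
  have e3 := mdot_eq_of_mulVec hM hc hp
  have e4 := mdot_eq_of_mulVec hM hp hp
  have e6 := mdot_comm p q
  rcases h4 with h | h | ⟨h | h | h, -⟩
  · exact h e4.symm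
  · refine h ?_
    simp only [gramTwo_eq, mdot_add_left, mdot_add_right, mdot_sub_right]
    rw [e1, e2, e3, e4, e6]; ring
  · exact h (mdot_eq_of_mulVec hM ha ha).symm
  · refine h ?_
    simp only [gramTwo_eq, mdot_add_left, mdot_add_right, mdot_sub_right]
    rw [e1, e2, e4, e6]; ring
  -- The two exchanges leave `[a, b, p, q]` unchanged while `M` negates it, so it vanishes; likewise
  -- `[b, c, p, q] = [a, c, p, q]`, nonzero by clause 1.
  · have b1 := bracket_eq_of_mulVec hM ha hb hp hq
    have b2 := bracket_eq_of_mulVec hM ha hc hp hq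
    have b3 := bracket_eq_of_mulVec hM hb hc hp hq
    have b4 := bracket_swap_left c a p q
    rw [bracket_swap_right] at b1 b2 b3
    rw [bracket_swap_left] at b1
    have b0 : bracket a b p q = 0 := by linarith
    refine h (symGramThree_eq_zero_of_bracket b0 (by linarith) fun h0 => ?_)
    rcases h1 with h | h | h
    · exact h b0
    · exact h h0
    · exact h (by linarith)

lemma not_conditionC_of_swap (hM : IsImproper M) (hp : M *ᵥ p = q)
    (h : mdot a p = mdot a q ∧ mdot b p = mdot b q ∧ mdot c p = mdot c q) :
    ¬ ConditionC p q a b c := by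
  obtain ⟨ha, hb, hc⟩ := h
  have e4 : mdot p p = mdot q q := (mdot_eq_of_mulVec hM hp hp).symm
  have e6 := mdot_comm p q
  rintro ⟨-, -, h | h | h | h, -⟩
  · exact h e4
  all_goals
    refine h ?_
    simp only [gramTwo_eq, mdot_add_left, mdot_add_right, mdot_sub_right]
    simp only [ha, hb, hc, e4, e6]; ring

lemma not_conditionC_of_hasImproperSymmetry (h : HasImproperSymmetry p q a b c) :
    ¬ ConditionC p q a b c := by
  obtain ⟨M, hM, ⟨hp, hq⟩ | ⟨hp, hq⟩, h⟩ := h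
  · rcases h with ⟨ha, hb, hc⟩ | ⟨ha, hb, hc⟩ | ⟨hb, hc, ha⟩ | ⟨hc, ha, hb⟩ | ⟨ha, hb, hc⟩ |
      ⟨hb, hc, ha⟩
    · have b1 := bracket_eq_of_mulVec hM ha hb hp hq
      have b2 := bracket_eq_of_mulVec hM hb hc hp hq
      have b3 := bracket_eq_of_mulVec hM hc ha hp hq
      rintro ⟨h | h | h, -⟩ <;> exact h (by linarith)
    · exact not_conditionC_of_transposition hM hp hq ha hb hc
    · exact fun h => not_conditionC_of_transposition hM hp hq hb hc ha h.rotate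
    · exact fun h => not_conditionC_of_transposition hM hp hq hc ha hb h.rotate.rotate
    -- A 3-cycle permutes the three brackets cyclically with a sign; three signs make each equal to
    -- its negative.
    · have b1 := bracket_eq_of_mulVec hM ha hb hp hq
      have b2 := bracket_eq_of_mulVec hM hb hc hp hq
      have b3 := bracket_eq_of_mulVec hM hc ha hp hq
      rintro ⟨h | h | h, -⟩ <;> exact h (by linarith)
    · have b1 := bracket_eq_of_mulVec hM ha hb hp hq
      have b2 := bracket_eq_of_mulVec hM hb hc hp hq
      have b3 := bracket_eq_of_mulVec hM hc ha hp hq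
      rintro ⟨h | h | h, -⟩ <;> exact h (by linarith)
  · rcases h with ⟨ha, hb, hc⟩ | ⟨ha, hb, hc⟩ | ⟨hb, hc, ha⟩ | ⟨hc, ha, hb⟩ | ⟨ha, hb, hc⟩ |
      ⟨hb, hc, ha⟩
    · exact not_conditionC_of_swap hM hp ⟨mdot_eq_of_mulVec hM ha hq,
        mdot_eq_of_mulVec hM hb hq, mdot_eq_of_mulVec hM hc hq⟩
    · exact not_conditionC_of_swap_transposition hM hp hq ha hb hc
    · exact fun h => not_conditionC_of_swap_transposition hM hp hq hb hc ha h.rotate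
    · exact fun h => not_conditionC_of_swap_transposition hM hp hq hc ha hb h.rotate.rotate
    -- Exchange plus 3-cycle has order six and makes all six products `x·p`, `x·q` equal.
    all_goals
      have e1 := mdot_eq_of_mulVec hM ha hp
      have e2 := mdot_eq_of_mulVec hM hb hp
      have e3 := mdot_eq_of_mulVec hM hc hp
      have e4 := mdot_eq_of_mulVec hM ha hq
      have e5 := mdot_eq_of_mulVec hM hb hq
      have e6 := mdot_eq_of_mulVec hM hc hq
      exact not_conditionC_of_swap hM hp ⟨by linarith, by linarith, by linarith⟩

end Symmetric

/-! ### A violated clause of `C` yields a reflection. -/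

section Construction

variable {p q a b c : FourVector}

/-- The vector orthogonal to `x`, `y`, `z` that represents `[x, y, z, ·]`. -/
def hodgeDual (x y z : FourVector) : FourVector :=
  metric *ᵥ fun i => bracket x y z (Pi.single i 1)

lemma mdot_hodgeDual (x y z w : FourVector) : mdot w (hodgeDual x y z) = bracket x y z w := by
  simp only [mdot, hodgeDual, metric_mulVec, bracket_eq]
  simp
  ring

/-- Otherwise all 2×2 minors of `(p, q)` vanish, but `(p·q)² - p²q²` is a signed sum of their
squares. -/
lemma exists_hodgeDual_ne_zero (h : msq p * msq q < mdot p q ^ 2) :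
    ∃ x, hodgeDual x p q ≠ 0 := by
  by_contra! h0
  have hb : ∀ x w, bracket x p q w = 0 := fun x w => by
    rw [← mdot_hodgeDual, h0]
    simp [mdot]
  have key : ∀ i j : Fin 4, bracket (Pi.single i 1) p q (Pi.single j 1) = 0 := fun i j => hb _ _
  have h01 := key 0 1
  have h02 := key 0 2
  have h03 := key 0 3
  have h12 := key 1 2
  have h13 := key 1 3
  have h23 := key 2 3
  simp [bracket_eq] at h01 h02 h03 h12 h13 h23
  refine h.ne ?_
  have : mdot p q ^ 2 - msq p * msq q =
      (p 0 * q 1 - p 1 * q 0) ^ 2 + (p 0 * q 2 - p 2 * q 0) ^ 2 + (p 0 * q 3 - p 3 * q 0) ^ 2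
      - (p 1 * q 2 - p 2 * q 1) ^ 2 - (p 1 * q 3 - p 3 * q 1) ^ 2
      - (p 2 * q 3 - p 3 * q 2) ^ 2 := by
    simp only [msq, mdot]; ring
  have e01 : p 0 * q 1 - p 1 * q 0 = 0 := by linarith
  have e02 : p 0 * q 2 - p 2 * q 0 = 0 := by linarith
  have e03 : p 0 * q 3 - p 3 * q 0 = 0 := by linarith
  have e12 : p 1 * q 2 - p 2 * q 1 = 0 := by linarith
  have e13 : p 1 * q 3 - p 3 * q 1 = 0 := by linarith
  have e23 : p 2 * q 3 - p 3 * q 2 = 0 := by linarith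
  rw [e01, e02, e03, e12, e13, e23] at this
  linarith

/-- If all brackets vanish, the five momenta have a common nonzero orthogonal vector. -/
lemma exists_orthogonal_of_bracket_eq_zero (h : msq p * msq q < mdot p q ^ 2)
    (hab : bracket a b p q = 0) (hbc : bracket b c p q = 0) (hca : bracket c a p q = 0) :
    ∃ v, v ≠ 0 ∧ mdot p v = 0 ∧ mdot q v = 0 ∧ mdot a v = 0 ∧ mdot b v = 0 ∧ mdot c v = 0 := by
  have hp : ∀ x, bracket x p q p = 0 := fun x => by simp only [bracket_eq]; ring
  have hq : ∀ x, bracket x p q q = 0 := fun x => by simp only [bracket_eq]; ring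
  have hs : ∀ x y, bracket x p q y = bracket x y p q := fun x y => by
    simp only [bracket_eq]; ring
  -- Any of `a, b, c` with nonzero dual serves as `x`; if none has one, every `x` with nonzero dual
  -- works.
  have main : ∀ x, hodgeDual x p q ≠ 0 → bracket x a p q = 0 → bracket x b p q = 0 →
      bracket x c p q = 0 → ∃ v, v ≠ 0 ∧ mdot p v = 0 ∧ mdot q v = 0 ∧ mdot a v = 0 ∧
        mdot b v = 0 ∧ mdot c v = 0 := fun x hx h1 h2 h3 =>
    ⟨hodgeDual x p q, hx, by simp only [mdot_hodgeDual, hp, hq, hs, h1, h2, h3, and_self]⟩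
  by_cases ha : hodgeDual a p q = 0
  · by_cases hb : hodgeDual b p q = 0
    · by_cases hc : hodgeDual c p q = 0
      · obtain ⟨x, hx⟩ := exists_hodgeDual_ne_zero h
        have hz : ∀ y, hodgeDual y p q = 0 → bracket x y p q = 0 := fun y hy => by
          rw [bracket_swap_left, ← hs, ← mdot_hodgeDual, hy]
          simp [mdot]
        exact main x hx (hz a ha) (hz b hb) (hz c hc)
      · exact main c hc hca (by rw [bracket_swap_left, hbc, neg_zero]) (bracket_self_left _ _ _)
    · exact main b hb (by rw [bracket_swap_left, hab, neg_zero]) (bracket_self_left _ _ _) hbc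
  · exact main a ha (bracket_self_left _ _ _) hab (by rw [bracket_swap_left, hca, neg_zero])

lemma hasImproperSymmetry_of_bracket (hP : 0 < msq (p + q))
    (h : msq p * msq q < mdot p q ^ 2) (hab : bracket a b p q = 0)
    (hbc : bracket b c p q = 0) (hca : bracket c a p q = 0) : HasImproperSymmetry p q a b c := by
  obtain ⟨v, hv, h1, h2, h3, h4, h5⟩ := exists_orthogonal_of_bracket_eq_zero h hab hbc hca
  have hvP : mdot v (p + q) = 0 := by rw [mdot_comm, mdot_add_left, h1, h2, add_zero]
  exact ⟨hyperplaneReflection v, isImproper_hyperplaneReflection (msq_neg_of_orthogonal hP hvP hv),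
    .inl ⟨hyperplaneReflection_of_orthogonal h1, hyperplaneReflection_of_orthogonal h2⟩,
    .inl ⟨hyperplaneReflection_of_orthogonal h3, hyperplaneReflection_of_orthogonal h4,
      hyperplaneReflection_of_orthogonal h5⟩⟩

/-- Equal masses give `(a - b)·(a + b) = 0`, so `h2` becomes `((a - b)·P)((a + b)·P) = 0`, and `a ≠
b` forces `(a - b)·P = 0`. The other two Gram determinants then reduce to `P²` times a product with
`a - b`, which is thus orthogonal to `p, q, c`. -/
lemma hasImproperSymmetry_of_transposition (hPc : p + q ∈ forwardCone) (hP : 0 < msq (p + q))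
    (ha : a ∈ forwardCone) (hb : b ∈ forwardCone) (hm : msq a = msq b)
    (h1 : gramTwo (a - b) (p + q) (p - q) (p + q) = 0)
    (h2 : gramTwo (a - b) (p + q) (a + b) (p + q) = 0)
    (h3 : gramTwo (a - b) (p + q) (a + b + c) (p + q) = 0) (hne : a ≠ b) :
    HasImproperSymmetry p q a b c := by
  have hm' : mdot (a - b) (a + b) = 0 := by
    simp only [msq] at hm
    simp only [mdot_add_right, mdot_sub_left, mdot_comm b a]
    linarith
  have hd : mdot (a - b) (p + q) = 0 := by
    rw [gramTwo_eq, hm', zero_mul, zero_sub, neg_eq_zero] at h2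
    refine (mul_eq_zero.1 h2).resolve_right fun h => hne ?_
    exact eq_of_mem_of_add_orthogonal hP hPc ha hb (by rwa [mdot_comm])
  have hz : ∀ y, gramTwo (a - b) (p + q) y (p + q) = 0 → mdot (a - b) y = 0 := fun y hy => by
    rw [gramTwo_eq, hd, zero_mul, sub_zero] at hy
    exact (mul_eq_zero.1 hy).resolve_right hP.ne'
  have hK := hz _ h1
  have hc := hz _ h3
  rw [mdot_add_right] at hd hc
  rw [mdot_sub_right] at hK
  have hv := msq_neg_of_orthogonal hP (by rw [mdot_add_right, hd]) (sub_ne_zero.2 hne)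
  have hab : a - b = (1 : ℝ) • (a - b) := (one_smul _ _).symm
  have hs : mdot (a + b) (a - b) = 0 := by rw [mdot_comm, hm']
  exact ⟨hyperplaneReflection (a - b), isImproper_hyperplaneReflection hv,
    .inl ⟨hyperplaneReflection_of_orthogonal (by rw [mdot_comm]; linarith),
      hyperplaneReflection_of_orthogonal (by rw [mdot_comm]; linarith)⟩,
    .inr (.inl ⟨hyperplaneReflection_eq hv.ne hab hs, hyperplaneReflection_eq_symm hv.ne hab hs,
      hyperplaneReflection_of_orthogonal (by rw [mdot_comm]; linarith)⟩)⟩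

lemma msq_sub_neg (h : msq p * msq q < mdot p q ^ 2) (hP : 0 < msq (p + q))
    (hm : msq p = msq q) : msq (p - q) < 0 := by
  have h1 : msq (p + q) * msq (p - q) = (msq p + msq q) ^ 2 - 4 * mdot p q ^ 2 := by
    simp only [msq, mdot, Pi.add_apply, Pi.sub_apply]; ring
  rw [hm] at h h1
  exact neg_of_mul_neg_right (by rw [h1]; linarith) hP.le

lemma mdot_add_sub_eq_zero (hm : msq p = msq q) : mdot (p + q) (p - q) = 0 := by
  have : mdot (p + q) (p - q) = msq p - msq q := by
    simp only [msq, mdot, Pi.add_apply, Pi.sub_apply]; ring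
  rw [this, hm, sub_self]

lemma mdot_sub_eq_zero_of_gramTwo (hP : 0 < msq (p + q)) (hm : msq p = msq q) {x : FourVector}
    (h : gramTwo x (p + q) (p - q) (p + q) = 0) : mdot x (p - q) = 0 := by
  rw [gramTwo_eq, mdot_add_sub_eq_zero hm, mul_zero, sub_zero] at h
  exact (mul_eq_zero.1 h).resolve_right hP.ne'

lemma hyperplaneReflection_swap (h : msq p * msq q < mdot p q ^ 2) (hP : 0 < msq (p + q))
    (hm : msq p = msq q) : hyperplaneReflection (p - q) *ᵥ p = q ∧
      hyperplaneReflection (p - q) *ᵥ q = p :=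
  have hv := (msq_sub_neg h hP hm).ne
  have hab : p - q = (1 : ℝ) • (p - q) := (one_smul _ _).symm
  ⟨hyperplaneReflection_eq hv hab (mdot_add_sub_eq_zero hm),
    hyperplaneReflection_eq_symm hv hab (mdot_add_sub_eq_zero hm)⟩

lemma hasImproperSymmetry_of_swap (h : msq p * msq q < mdot p q ^ 2) (hP : 0 < msq (p + q))
    (hm : msq p = msq q) (ha : gramTwo a (p + q) (p - q) (p + q) = 0)
    (hb : gramTwo b (p + q) (p - q) (p + q) = 0) (hc : gramTwo c (p + q) (p - q) (p + q) = 0) :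
    HasImproperSymmetry p q a b c :=
  ⟨hyperplaneReflection (p - q), isImproper_hyperplaneReflection (msq_sub_neg h hP hm),
    .inr (hyperplaneReflection_swap h hP hm),
    .inl ⟨hyperplaneReflection_of_orthogonal (mdot_sub_eq_zero_of_gramTwo hP hm ha),
      hyperplaneReflection_of_orthogonal (mdot_sub_eq_zero_of_gramTwo hP hm hb),
      hyperplaneReflection_of_orthogonal (mdot_sub_eq_zero_of_gramTwo hP hm hc)⟩⟩

/-- If the Gram determinant of `u, p, q` vanishes, then `u` lies in the span of `p` and `q`. -/
lemma exists_eq_of_symGramThree_eq_zero (h : msq p * msq q < mdot p q ^ 2)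
    (hP : 0 < msq (p + q)) {u : FourVector} (hu : symGramThree u p q = 0) :
    ∃ r s : ℝ, u = r • p + s • q := by
  -- `A / D` and `B / D` are the coefficients of the projection of `u` onto the span of `p, q`. The
  -- scaled remainder has square `D Δ₃ = 0` and is orthogonal to the timelike `P`, so it is zero.
  obtain ⟨D, hD⟩ : ∃ D, D = msq p * msq q - mdot p q ^ 2 := ⟨_, rfl⟩
  have hD0 : D ≠ 0 := by rw [hD]; linarith
  obtain ⟨A, hA⟩ : ∃ A, A = mdot u p * msq q - mdot u q * mdot p q := ⟨_, rfl⟩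
  obtain ⟨B, hB⟩ : ∃ B, B = mdot u q * msq p - mdot u p * mdot p q := ⟨_, rfl⟩
  have hw : D • u - (A • p + B • q) = 0 := by
    by_contra hne
    have h1 : mdot (D • u - (A • p + B • q)) (p + q) = 0 := by
      simp only [mdot_add_left, mdot_add_right, mdot_sub_left, mdot_smul_left, mdot_comm q p,
        hA, hB, hD, msq]
      ring
    have h2 : msq (D • u - (A • p + B • q)) = D * symGramThree u p q := by
      simp only [symGramThree_eq, mdot_add_left, mdot_add_right, mdot_sub_left, mdot_sub_right,
        mdot_smul_left, mdot_smul_right, mdot_comm q p, mdot_comm p u, mdot_comm q u,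
        hA, hB, hD, msq]
      ring
    have h3 := msq_neg_of_orthogonal hP h1 hne
    rw [h2, hu, mul_zero] at h3
    exact h3.false
  refine ⟨D⁻¹ * A, D⁻¹ * B, ?_⟩
  rw [mul_smul, mul_smul, ← smul_add, ← sub_eq_zero.1 hw, inv_smul_smul₀ hD0]

lemma hasImproperSymmetry_of_swap_transposition (h : msq p * msq q < mdot p q ^ 2)
    (hPc : p + q ∈ forwardCone) (hP : 0 < msq (p + q)) (ha : a ∈ forwardCone)
    (hb : b ∈ forwardCone) (hm : msq p = msq q)
    (habc : gramTwo (a + b + c) (p + q) (p - q) (p + q) = 0) (hab : msq a = msq b)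
    (hK : gramTwo (a + b) (p + q) (p - q) (p + q) = 0) (hΔ : symGramThree (a - b) p q = 0) :
    HasImproperSymmetry p q a b c := by
  have hK' := mdot_sub_eq_zero_of_gramTwo hP hm hK
  have habc' := mdot_sub_eq_zero_of_gramTwo hP hm habc
  have hc : mdot c (p - q) = 0 := by
    rw [mdot_add_left, hK', zero_add] at habc'
    exact habc'
  have hv := msq_sub_neg h hP hm
  have hs : ∃ s : ℝ, a - b = s • (p - q) := by
    obtain ⟨r, s, hrs⟩ := exists_eq_of_symGramThree_eq_zero h hP hΔ
    -- `a + b` is orthogonal to both `a - b = r p + s q` and `p - q`. So either `s = -r` and `a - b`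
    -- is parallel to `p - q`, or `a = b`.
    have h1 : (r + s) * mdot (a + b) (p + q) = 0 := by
      have h2 : mdot (a + b) (a - b) = 0 := mdot_add_sub_eq_zero hab
      rw [hrs, mdot_add_right, mdot_smul_right, mdot_smul_right] at h2
      rw [mdot_sub_right] at hK'
      rw [mdot_add_right]
      linear_combination 2 * h2 - (r - s) * hK'
    rcases mul_eq_zero.1 h1 with h1 | h1
    · refine ⟨r, ?_⟩
      rw [hrs, eq_neg_of_add_eq_zero_right h1, neg_smul, smul_sub, sub_eq_add_neg]
    · exact ⟨0, by rw [eq_of_mem_of_add_orthogonal hP hPc ha hb h1, sub_self, zero_smul]⟩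
  obtain ⟨s, hs⟩ := hs
  exact ⟨hyperplaneReflection (p - q), isImproper_hyperplaneReflection hv,
    .inr (hyperplaneReflection_swap h hP hm),
    .inr (.inl ⟨hyperplaneReflection_eq hv.ne hs hK', hyperplaneReflection_eq_symm hv.ne hs hK',
      hyperplaneReflection_of_orthogonal hc⟩)⟩

lemma hasImproperSymmetry_of_not_conditionC (hp : p ∈ forwardCone) (hq : q ∈ forwardCone)
    (ha : a ∈ forwardCone) (hb : b ∈ forwardCone) (hc : c ∈ forwardCone)
    (h : msq p * msq q < mdot p q ^ 2) (hC : ¬ ConditionC p q a b c) :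
    HasImproperSymmetry p q a b c := by
  have hP := msq_add_pos hp hq h
  have hPc := add_mem_forwardCone hp hq
  have hbca : b + c + a = a + b + c := by abel
  have hcab : c + a + b = a + b + c := by abel
  simp only [ConditionC, not_and_or, not_or, not_not, ne_eq] at hC
  rcases hC with h1 | (h1 | h1 | h1) | h1 | ⟨hm, hK, h1 | h1 | h1⟩
  · exact hasImproperSymmetry_of_bracket hP h h1.1 h1.2.1 h1.2.2
  · obtain ⟨h1, h2, h3, h4, h5⟩ := h1
    exact hasImproperSymmetry_of_transposition hPc hP ha hb h1 h2 h3 h4 h5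
  · obtain ⟨h1, h2, h3, h4, h5⟩ := h1
    exact (hasImproperSymmetry_of_transposition hPc hP hb hc h1 h2 h3
      (by rwa [hbca]) h5).rotate.rotate
  · obtain ⟨h1, h2, h3, h4, h5⟩ := h1
    exact (hasImproperSymmetry_of_transposition hPc hP hc ha h1 h2 h3 (by rwa [hcab]) h5).rotate
  · obtain ⟨h1, h2, h3, h4⟩ := h1
    exact hasImproperSymmetry_of_swap h hP h1 h2 h3 h4
  · obtain ⟨h1, h2, h3⟩ := h1
    exact hasImproperSymmetry_of_swap_transposition h hPc hP ha hb hm hK h1 h2 h3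
  · obtain ⟨h1, h2, h3⟩ := h1
    exact (hasImproperSymmetry_of_swap_transposition h hPc hP hb hc hm (by rwa [hbca])
      h1 h2 h3).rotate.rotate
  · obtain ⟨h1, h2, h3⟩ := h1
    exact (hasImproperSymmetry_of_swap_transposition h hPc hP hc ha hm (by rwa [hcab])
      h1 h2 h3).rotate

end Construction

end Collider

end

open Collider
theorem mainTheorem1 (p q a b c : Momentum) (hcol : (mkEvent p q a b c).IsCollision) :
    (mkEvent p q a b c).IsChiral ↔ ConditionC p q a b c := by
  rw [Event.IsChiral, equivalent_parity_mkEvent_iff]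
  constructor
  · intro h
    by_contra hC
    exact h (hasImproperSymmetry_of_not_conditionC p.2 q.2 a.2 b.2 c.2 hcol hC)
  · exact fun hC h => not_conditionC_of_hasImproperSymmetry h hC
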